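/- For integers $d\ge 2$, $0<\rho<1$ and a nonempty $I\subseteq[d]=\{1,\dots,d\}$, let $\mu_{I,\rho}$ be the probability distribution on $\{-1,1\}^d$ given by $\mu_{I,\rho}(x)=2^{-d}\bigl(1+\rho\prod_{i\in I}x_i\bigr)$, and let $\mathcal{P}_{\mathcal{I}_r,\rho}=\{\mu_{I,\rho} : I\subseteq[d],\ |I|=r\}$. A $(t,s)$-algorithm identifying $\mu\in\mathcal{P}_{\mathcal{I}_r,\rho}$ (with error $1/3$) consists of an initial memory state $u_1\in\{0,1\}^s$, arbitrary functions $f_1,\dots,f_t:\{-1,1\}^d\times\{0,1\}^s\to\{0,1\}^s$, and an arbitrary output function $g$ from $\{0,1\}^s$ to the $r$-subsets of $[d]$, such that for every $I\subseteq[d]$ with $|I|=r$: if $x_1,\dots,x_t$ are i.i.d. samples from $\mu_{I,\rho}$ and $u_{j+1}=f_j(x_j,u_j)$ for $1\le j\le t$, then $g(u_{t+1})=I$ with probability at least $2/3$. **Theorem.** There exist a numerical constant $C'>0$ and a positive function $C(r)$ of $r\in\mathbb{N}$ such that the following holds. Let $2\le r\le d-1$ be integers, let $0<\rho<1$ satisfy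 $$\rho\le \frac{d^{-3r/2}\,(\ln d)^{-1/2}}{C(r)},$$ and let $t,s\ge 1$ be integers. Then any $(t,s)$-algorithm identifying $\mu\in\mathcal{P}_{\mathcal{I}_r,\rho}$ satisfies $$ts\ \ge\ \frac{\binom{d}{r}}{C'\rho^2\ln\binom{d}{r}}.\qquad(*)$$ Furthermore, for every odd $r\ge 2$ and every $0<\varepsilon<1$ there exists a number $C(r,\varepsilon)\ge 1$, depending only on $r$ and $\varepsilon$, such that for all $d\ge r+1$, all $0<\rho<1$ with $\rho\le d^{-(1+\varepsilon)r}/C(r,\varepsilon)$ and all integers $t,s\ge1$, any $(t,s)$-algorithm identifying $\mu\in\mathcal{P}_{\mathcal{I}_r,\rho}$ satisfies $(*)$, with the same constant $C'$. -/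

import Mathlib

/-- The distribution `μ_{I,ρ}` on `{-1,1}^d`, given by its probability mass function
`μ_{I,ρ}(x) = 2^{-d} (1 + ρ ∏_{i ∈ I} x_i)`. The two-point set `{-1,1}` is `ℤˣ`. -/
noncomputable def correlatedDist (d : ℕ) (ρ : ℝ) (I : Finset (Fin d)) (x : Fin d → ℤˣ) : ℝ :=
  (2 : ℝ)⁻¹ ^ d * (1 + ρ * ∏ i ∈ I, (((x i : ℤˣ) : ℤ) : ℝ))

theorem correlatedDist_nonneg {d : ℕ} {ρ : ℝ} (h0 : 0 ≤ ρ) (h1 : ρ ≤ 1) (I : Finset (Fin d))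
    (x : Fin d → ℤˣ) : 0 ≤ correlatedDist d ρ I x := by
  have h : |∏ i ∈ I, (((x i : ℤˣ) : ℤ) : ℝ)| = 1 := by
    rw [Finset.abs_prod]
    refine Finset.prod_eq_one fun i _ => ?_
    rcases Int.units_eq_one_or (x i) with h | h <;> simp [h]
  have h2 := neg_abs_le (∏ i ∈ I, (((x i : ℤˣ) : ℤ) : ℝ))
  rw [h] at h2
  unfold correlatedDist
  have : 0 ≤ 1 + ρ * ∏ i ∈ I, (((x i : ℤˣ) : ℤ) : ℝ) := by nlinarith
  positivity

theorem correlatedDist_sum {d : ℕ} (ρ : ℝ) {I : Finset (Fin d)} (hI : I.Nonempty) :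
    ∑ x : Fin d → ℤˣ, correlatedDist d ρ I x = 1 := by
  have hcard : Fintype.card (Fin d → ℤˣ) = 2 ^ d := by simp
  have hz : ∑ x : Fin d → ℤˣ, ∏ i ∈ I, (((x i : ℤˣ) : ℤ) : ℝ) = 0 := by
    have hprod : ∀ x : Fin d → ℤˣ, ∏ i ∈ I, (((x i : ℤˣ) : ℤ) : ℝ)
        = ∏ i, (if i ∈ I then (((x i : ℤˣ) : ℤ) : ℝ) else 1) := fun x => by
      simp [Finset.prod_ite_mem]
    simp_rw [hprod]
    rw [← Fintype.prod_sum (fun (i : Fin d) (u : ℤˣ) => if i ∈ I then ((u : ℤ) : ℝ) else 1)]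
    obtain ⟨i, hi⟩ := hI
    refine Finset.prod_eq_zero (Finset.mem_univ i) ?_
    simp [hi, show (Finset.univ : Finset ℤˣ) = {1, -1} from rfl]
  unfold correlatedDist
  rw [← Finset.mul_sum, Finset.sum_add_distrib, ← Finset.mul_sum, hz, Finset.sum_const,
    Finset.card_univ, hcard]
  simp

/-- The family `𝒫_{𝓘_r,ρ} = {μ_{I,ρ} : I ⊆ [d], |I| = r}`, indexed by the `r`-subsets. -/
noncomputable def orderCorrelations (d r : ℕ) (ρ : ℝ) :
    {I : Finset (Fin d) // I.card = r} → (Fin d → ℤˣ) → ℝ :=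
  fun I => correlatedDist d ρ I.1

/-- A one-pass algorithm reading `t` data points from `Ω` in order, with `s` bits of memory, and
outputting an index in `ι`. The memory content after the `j`-th data point is an arbitrary
function, which may depend on `j`, of that point and of the previous memory content; the output is
an arbitrary function of the final memory content. -/
structure StreamingAlgorithm (Ω ι : Type*) (t s : ℕ) where
  init : Fin s → Bool
  step : Fin t → Ω → (Fin s → Bool) → (Fin s → Bool)
  output : (Fin s → Bool) → ι

namespace StreamingAlgorithm

variable {Ω ι : Type*} {t s : ℕ}

/-- The memory content after all `t` data points have been processed in order. -/
def finalState (A : StreamingAlgorithm Ω ι t s) (x : Fin t → Ω) : Fin s → Bool :=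
  Fin.foldl t (fun u j => A.step j (x j) u) A.init

def run (A : StreamingAlgorithm Ω ι t s) (x : Fin t → Ω) : ι :=
  A.output (A.finalState x)

/-- The probability, over `t` i.i.d. samples from the distribution with mass function `p` on the
finite sample space `Ω`, that the algorithm outputs `i`. -/
noncomputable def outputProb [Fintype Ω] [DecidableEq ι] (A : StreamingAlgorithm Ω ι t s)
    (p : Ω → ℝ) (i : ι) : ℝ :=
  ∑ x : Fin t → Ω with A.run x = i, ∏ j, p (x j)

/-- `A` identifies `μ ∈ {μ_i : i ∈ ι}` with error `ε`: for every `i`, given i.i.d. samples from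
`μ_i` it outputs `i` with probability at least `1 - ε`. -/
def Identifies [Fintype Ω] [DecidableEq ι] (A : StreamingAlgorithm Ω ι t s)
    (μ : ι → Ω → ℝ) (ε : ℝ) : Prop :=
  ∀ i, 1 - ε ≤ A.outputProb (μ i) i

end StreamingAlgorithm

/-! Compare the uniform law `w` with the K = `d.choose r` alternatives `w (1 + ρ χ_I)`. The parities
χ_I are signs, centred and pairwise uncorrelated under `w`; only this is used. Under `w` the output
probabilities sum to 1, while under alternative I the output I has probability at least 2/3. Hence
the relative entropies D(null ‖ I) of the final memory sum to at least K/10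
(`Identifies.le_sum_relEntropy`).

For the upper bound, cut the stream into batches of m = K s samples. With the null law in first
place, the chain rule averages over starting states with weights independent of I, so the sum over I
can be bounded batch by batch, for each fixed starting state (`sum_relEntropy_stateLaw_le`). On one
batch the memory is a map F to 2^s states. Up to higher-order errors the divergence is governed by
the conditional means, given F, of the empirical correlations ∑_j χ_I(X_j). A subgaussian bound,
tested in the direction of the mean vector itself, shows that conditioning on an event of
probability p biases the correlations by a vector of squared length O(m (s + log² p / s))
(`sum_sq_conditional_mean_le`). Averaged over 2^s states this is O(m s) (`sum_first_order_le`).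

So a batch contributes O(s m ρ²), the condition ρ K ≤ 1 absorbing K copies of the error (m ρ²)²
(`sum_relEntropy_batch_le`). About t/m batches give K = O(ρ² t s), with no logarithm; if s ≥ K/20,
the memory-free bound t ρ² ≥ 1/20 suffices instead. Both ranges of ρ in the theorem lie inside ρ ≤
d^(-r) ≤ 1/K. -/

/-! ### Relative entropy of image measures -/

section RelativeEntropy

variable {α σ τ : Type*}

/-- The image of the mass function `w` under the map `F`. -/
noncomputable def pushMass [Fintype α] [DecidableEq σ] (F : α → σ) (w : α → ℝ) (u : σ) : ℝ :=
  ∑ x with F x = u, w x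

/-- The relative entropy (Kullback–Leibler divergence) of two mass functions on a finite type. -/
noncomputable def relEntropy [Fintype σ] (p q : σ → ℝ) : ℝ :=
  ∑ u, p u * Real.log (p u / q u)

theorem pushMass_nonneg [Fintype α] [DecidableEq σ] (F : α → σ) {w : α → ℝ} (hw : ∀ x, 0 ≤ w x)
    (u : σ) : 0 ≤ pushMass F w u :=
  Finset.sum_nonneg fun x _ => hw x

theorem sum_pushMass [Fintype α] [Fintype σ] [DecidableEq σ] (F : α → σ) (w : α → ℝ) :
    ∑ u, pushMass F w u = ∑ x, w x :=
  Finset.sum_fiberwise _ _ _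

theorem pushMass_pos_of_pos [Fintype α] [DecidableEq σ] (F : α → σ) {w w' : α → ℝ}
    (hw' : ∀ x, 0 < w' x) {u : σ} (h : pushMass F w u ≠ 0) : 0 < pushMass F w' u := by
  obtain ⟨x, hx, -⟩ := Finset.exists_ne_zero_of_sum_ne_zero h
  exact Finset.sum_pos (fun y _ => hw' y) ⟨x, hx⟩

/-- The log-sum inequality. -/
theorem log_sum_inequality [Fintype α] {a b : α → ℝ} (ha : ∀ i, 0 ≤ a i) (hb : ∀ i, 0 ≤ b i)
    (hab : ∀ i, a i ≠ 0 → 0 < b i) :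
    (∑ i, a i) * Real.log ((∑ i, a i) / ∑ i, b i) ≤ ∑ i, a i * Real.log (a i / b i) := by
  by_cases hA : ∑ i, a i = 0
  · have h0 := (Finset.sum_eq_zero_iff_of_nonneg fun i _ => ha i).1 hA
    rw [hA, zero_mul]
    exact (Finset.sum_eq_zero fun i hi => by rw [h0 i hi, zero_mul]).ge
  obtain ⟨j, -, hj⟩ := Finset.exists_ne_zero_of_sum_ne_zero hA
  have hApos : 0 < ∑ i, a i := lt_of_le_of_ne (Finset.sum_nonneg fun i _ => ha i) (Ne.symm hA)
  have hBpos : 0 < ∑ i, b i :=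
    Finset.sum_pos' (fun i _ => hb i) ⟨j, Finset.mem_univ j, hab j hj⟩
  set A := ∑ i, a i
  set B := ∑ i, b i
  have key : ∀ i, a i * Real.log (A / B) + (a i - b i * (A / B)) ≤ a i * Real.log (a i / b i) := by
    intro i
    rcases (ha i).eq_or_lt with h | h
    · rw [← h]
      have : 0 ≤ b i * (A / B) := mul_nonneg (hb i) (by positivity)
      simpa using this
    · have hbi := hab i h.ne'
      have hl := Real.one_sub_inv_le_log_of_pos (show 0 < (a i / b i) / (A / B) by positivity)
      rw [Real.log_div (by positivity) (by positivity)] at hl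
      have := mul_le_mul_of_nonneg_left hl h.le
      have e : a i * (1 - ((a i / b i) / (A / B))⁻¹) = a i - b i * (A / B) := by
        field_simp
      linarith
  calc A * Real.log (A / B) = ∑ i, (a i * Real.log (A / B) + (a i - b i * (A / B))) := by
        rw [Finset.sum_add_distrib, Finset.sum_sub_distrib, ← Finset.sum_mul, ← Finset.sum_mul]
        change _ = A * _ + (A - B * (A / B))
        field_simp
        ring
    _ ≤ _ := Finset.sum_le_sum fun i _ => key i

/-- Relative entropy after one Markov step is at most the initial relative entropy plus the average
relative entropy of the transition kernels. -/
theorem relEntropy_comp_le [Fintype σ] [Fintype τ] {p q : σ → ℝ} {P Q : σ → τ → ℝ}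
    (hp : ∀ u, 0 ≤ p u) (hq : ∀ u, 0 ≤ q u) (hpq : ∀ u, p u ≠ 0 → 0 < q u)
    (hP : ∀ u v, 0 ≤ P u v) (hQ : ∀ u v, 0 ≤ Q u v) (hPQ : ∀ u v, P u v ≠ 0 → 0 < Q u v)
    (hP1 : ∀ u, ∑ v, P u v = 1) :
    relEntropy (fun v => ∑ u, p u * P u v) (fun v => ∑ u, q u * Q u v)
      ≤ relEntropy p q + ∑ u, p u * relEntropy (P u) (Q u) := by
  calc relEntropy (fun v => ∑ u, p u * P u v) (fun v => ∑ u, q u * Q u v)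
      ≤ ∑ v, ∑ u, p u * P u v * Real.log (p u * P u v / (q u * Q u v)) := by
        refine Finset.sum_le_sum fun v _ => log_sum_inequality
          (fun u => mul_nonneg (hp u) (hP u v)) (fun u => mul_nonneg (hq u) (hQ u v)) fun u h => ?_
        exact mul_pos (hpq u (left_ne_zero_of_mul h)) (hPQ u v (right_ne_zero_of_mul h))
    _ = ∑ u, ∑ v, (p u * Real.log (p u / q u) * P u v
          + p u * (P u v * Real.log (P u v / Q u v))) := by
        rw [Finset.sum_comm]
        refine Finset.sum_congr rfl fun u _ => Finset.sum_congr rfl fun v _ => ?_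
        by_cases h1 : p u = 0
        · simp [h1]
        by_cases h2 : P u v = 0
        · simp [h2]
        have hqu := hpq u h1
        have hQu := hPQ u v h2
        rw [mul_div_mul_comm, Real.log_mul (div_ne_zero h1 hqu.ne') (div_ne_zero h2 hQu.ne')]
        ring
    _ = relEntropy p q + ∑ u, p u * relEntropy (P u) (Q u) := by
        unfold relEntropy
        rw [← Finset.sum_add_distrib]
        refine Finset.sum_congr rfl fun u _ => ?_
        rw [Finset.sum_add_distrib, ← Finset.mul_sum, hP1, mul_one, ← Finset.mul_sum]

/-- The relative entropy of image measures is at most the `χ²`-divergence of the measures. -/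
theorem relEntropy_pushMass_le_sum_div [Fintype α] [Fintype σ] [DecidableEq σ] (F : α → σ)
    {w L : α → ℝ} (hw : ∀ x, 0 < w x) (hL : ∀ x, 0 < L x) :
    relEntropy (pushMass F w) (pushMass F fun x => w x * L x) ≤ ∑ x, w x / L x - ∑ x, w x := by
  rw [← sum_pushMass F w, ← sum_pushMass F fun x => w x / L x, ← Finset.sum_sub_distrib]
  refine Finset.sum_le_sum fun u _ => ?_
  by_cases h0 : pushMass F w u = 0
  · rw [h0, zero_mul, sub_zero]
    exact pushMass_nonneg F (fun x => (div_pos (hw x) (hL x)).le) u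
  have hp := pushMass_pos_of_pos F hw h0
  have hq := pushMass_pos_of_pos F (fun x => mul_pos (hw x) (hL x)) h0
  have h2 : (pushMass F w u) ^ 2 / pushMass F (fun x => w x * L x) u
      ≤ pushMass F (fun x => w x / L x) u := by
    refine (Finset.sq_sum_div_le_sum_sq_div _ w
      fun x _ => mul_pos (hw x) (hL x)).trans_eq (Finset.sum_congr rfl fun x _ => ?_)
    have := hw x
    have := hL x
    field_simp
  have h3 := mul_le_mul_of_nonneg_left (Real.log_le_sub_one_of_pos (div_pos hp hq)) hp.le
  have e : pushMass F w u * (pushMass F w u / pushMass F (fun x => w x * L x) u - 1)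
    = (pushMass F w u) ^ 2 / pushMass F (fun x => w x * L x) u - pushMass F w u := by ring
  linarith

/-- Expand 1/y - 1 ≥ -log y geometrically about y = 1; the cubic term is absorbed by the quadratic
one. The linear term stays exact because it will sum to zero. -/
theorem neg_log_le_quadratic_add {y : ℝ} (hy : 0 < y) :
    -Real.log y ≤ (1 - y) + 2 * (1 - y) ^ 2 + (1 - y) ^ 4 / y := by
  have h := Real.one_sub_inv_le_log_of_pos hy
  have e : y⁻¹ - 1 = (1 - y) + (1 - y) ^ 2 + (1 - y) ^ 3 + (1 - y) ^ 4 / y := by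
    field_simp
    ring
  have h3 : (1 - y) ^ 3 ≤ (1 - y) ^ 2 := by
    nlinarith [mul_nonneg (sq_nonneg (1 - y)) hy.le]
  linarith

/-- A bound on the relative entropy of image measures by a quadratic main term, which depends on
the map, and a fourth order error term, which does not. -/
theorem relEntropy_pushMass_le_quadratic [Fintype α] [Fintype σ] [DecidableEq σ] (F : α → σ)
    {w L : α → ℝ} (hw : ∀ x, 0 < w x) (hL : ∀ x, 0 < L x) (h1 : ∑ x, w x * L x = ∑ x, w x) :
    relEntropy (pushMass F w) (pushMass F fun x => w x * L x)
      ≤ 2 * ∑ u, (pushMass F (fun x => w x * (L x - 1)) u) ^ 2 / pushMass F w u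
        + ∑ x, w x * ((1 - L x) ^ 4 / L x) := by
  -- Both image measures have the same mass, so ∑ (p - q) = 0 can be inserted to match the linear
  -- term of the pointwise logarithm bound.
  have hsum : ∑ u, (pushMass F w u - pushMass F (fun x => w x * L x) u) = 0 := by
    rw [Finset.sum_sub_distrib, sum_pushMass, sum_pushMass, h1, sub_self]
  rw [← zero_add (2 * _), ← hsum, ← sum_pushMass F, Finset.mul_sum, ← Finset.sum_add_distrib,
    ← Finset.sum_add_distrib]
  refine Finset.sum_le_sum fun u _ => ?_
  have hd : pushMass F (fun x => w x * (L x - 1)) u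
      = pushMass F (fun x => w x * L x) u - pushMass F w u := by
    unfold pushMass
    rw [← Finset.sum_sub_distrib]
    exact Finset.sum_congr rfl fun x _ => by ring
  by_cases h0 : pushMass F w u = 0
  · have hempty : ∀ x, F x ≠ u := fun x hx => by
      refine (Finset.sum_pos (fun y _ => hw y) ?_).ne' h0
      exact ⟨x, Finset.mem_filter.2 ⟨Finset.mem_univ x, hx⟩⟩
    have hz : ∀ v : α → ℝ, pushMass F v u = 0 := fun v =>
      Finset.sum_eq_zero fun x hx => absurd (Finset.mem_filter.1 hx).2 (hempty x)
    simp [hz]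
  have hp := pushMass_pos_of_pos F hw h0
  have hq := pushMass_pos_of_pos F (fun x => mul_pos (hw x) (hL x)) h0
  -- Cauchy–Schwarz on the fibre, used twice: the quartic remainder is (((q - p)² / p)²) / q,
  -- bounded first through (1 - L)² and then through (1 - L)⁴ / L.
  have h2 : (pushMass F (fun x => w x * (L x - 1)) u) ^ 2 / pushMass F w u
      ≤ pushMass F (fun x => w x * (1 - L x) ^ 2) u := by
    refine (Finset.sq_sum_div_le_sum_sq_div _ _
      fun x _ => hw x).trans_eq (Finset.sum_congr rfl fun x _ => ?_)
    have := hw x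
    field_simp
    ring
  have h4 : (pushMass F (fun x => w x * (1 - L x) ^ 2) u) ^ 2 / pushMass F (fun x => w x * L x) u
      ≤ pushMass F (fun x => w x * ((1 - L x) ^ 4 / L x)) u := by
    refine (Finset.sq_sum_div_le_sum_sq_div _ _
      fun x _ => mul_pos (hw x) (hL x)).trans_eq (Finset.sum_congr rfl fun x _ => ?_)
    have := hw x
    have := hL x
    field_simp
  rw [hd] at h2 ⊢
  set p := pushMass F w u
  set q := pushMass F (fun x => w x * L x) u
  have h5 : ((q - p) ^ 2 / p) ^ 2 / q ≤ pushMass F (fun x => w x * ((1 - L x) ^ 4 / L x)) u :=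
    (div_le_div_of_nonneg_right (pow_le_pow_left₀ (by positivity) h2 2) hq.le).trans h4
  have h6 := mul_le_mul_of_nonneg_left (neg_log_le_quadratic_add (div_pos hq hp)) hp.le
  have e1 : -Real.log (q / p) = Real.log (p / q) := by rw [← Real.log_inv, inv_div]
  have e2 : p * (1 - q / p + 2 * (1 - q / p) ^ 2 + (1 - q / p) ^ 4 / (q / p))
      = (p - q) + 2 * ((q - p) ^ 2 / p) + ((q - p) ^ 2 / p) ^ 2 / q := by
    field_simp
    ring
  rw [e1, e2] at h6
  linarith

/-- If an event has large probability under `q`, its probability under `p` is large or the relative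
entropy of `p` and `q` is. -/
theorem relEntropy_ge_of_event [Fintype σ] {p q : σ → ℝ} (hp : ∀ u, 0 ≤ p u)
    (hq : ∀ u, 0 ≤ q u) (hpq : ∀ u, p u ≠ 0 → 0 < q u) (hp1 : ∑ u, p u = 1) (hq1 : ∑ u, q u = 1)
    (E : σ → Prop) [DecidablePred E] (hE : 2 / 3 ≤ ∑ u with E u, q u) :
    1 / 3 - 7 / 10 * ∑ u with E u, p u ≤ relEntropy p q := by
  set l := Real.log 2
  have hl : l ≤ 7 / 10 := by have := Real.log_two_lt_d9; simp only [l]; linarith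
  -- Gibbs' inequality for `p` against `q` tilted by 1/2 on the event and scaled by 3/2; the tilted
  -- mass is (3/2)(1 - q(E)/2) ≤ 1. The loss from tilting is log(3/2) ≥ 1/3 against p(E) log 2.
  have key : ∀ u, p u * (4 / 3) - 3 / 2 * (q u * if E u then 1 / 2 else 1)
      - l * (if E u then p u else 0) ≤ p u * Real.log (p u / q u) := by
    intro u
    rcases (hp u).eq_or_lt with h | h
    · rw [← h]
      have : 0 ≤ q u * if E u then (1 / 2 : ℝ) else 1 := mul_nonneg (hq u) (by split_ifs <;> norm_num)
      simp only [ite_self]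
      linarith
    have hqu := hpq u h.ne'
    have hlog : Real.log (2 / 3 : ℝ) ≤ -(1 / 3) := by
      have := Real.log_le_sub_one_of_pos (show (0 : ℝ) < 2 / 3 by norm_num)
      linarith
    split_ifs with hu
    · have h1 := Real.one_sub_inv_le_log_of_pos (show 0 < p u / q u * 2 * (2 / 3) by positivity)
      rw [Real.log_mul (by positivity) (by norm_num), Real.log_mul (by positivity) (by norm_num)]
        at h1
      have h2 := mul_le_mul_of_nonneg_left h1 h.le
      have e : p u * (1 - (p u / q u * 2 * (2 / 3))⁻¹) = p u - 3 / 2 * (q u * (1 / 2)) := by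
        field_simp
      nlinarith
    · have h1 := Real.one_sub_inv_le_log_of_pos (show 0 < p u / q u * (2 / 3) by positivity)
      rw [Real.log_mul (by positivity) (by norm_num)] at h1
      have h2 := mul_le_mul_of_nonneg_left h1 h.le
      have e : p u * (1 - (p u / q u * (2 / 3))⁻¹) = p u - 3 / 2 * q u := by
        field_simp
      nlinarith
  have hs := Finset.sum_le_sum fun u (_ : u ∈ Finset.univ) => key u
  rw [Finset.sum_sub_distrib, Finset.sum_sub_distrib, ← Finset.sum_mul, hp1, ← Finset.mul_sum,
    ← Finset.mul_sum, ← Finset.sum_filter] at hs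
  have hq2 : ∑ u, (q u * if E u then (1 / 2 : ℝ) else 1) = 1 - 1 / 2 * ∑ u with E u, q u := by
    rw [show (1 : ℝ) - 1 / 2 * ∑ u with E u, q u = ∑ u, q u - 1 / 2 * ∑ u with E u, q u by rw [hq1],
      Finset.mul_sum, Finset.sum_filter, ← Finset.sum_sub_distrib]
    refine Finset.sum_congr rfl fun u _ => ?_
    split_ifs <;> ring
  rw [hq2] at hs
  have hpE : 0 ≤ ∑ u with E u, p u := Finset.sum_nonneg fun u _ => hp u
  change _ ≤ relEntropy p q at hs
  nlinarith

end RelativeEntropy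

/-! ### Moments of the likelihood ratio for uncorrelated signs -/

section SignFamilies

variable {Ω ι σ : Type*}

/-- A family of sign functions that are centred and uncorrelated under a mass function `w` of full
support. -/
structure IsUncorrelatedSigns [Fintype Ω] (w : Ω → ℝ) (χ : ι → Ω → ℝ) : Prop where
  weight_pos : ∀ x, 0 < w x
  weight_sum : ∑ x, w x = 1
  sq_eq_one : ∀ i x, χ i x ^ 2 = 1
  mean_zero : ∀ i, ∑ x, w x * χ i x = 0
  uncorrelated : ∀ i j, i ≠ j → ∑ x, w x * (χ i x * χ j x) = 0

/-- The mass function of `m` independent samples. -/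
noncomputable def iidMass (w : Ω → ℝ) (m : ℕ) (X : Fin m → Ω) : ℝ := ∏ j, w (X j)

/-- The likelihood ratio of `m` independent samples from the density `1 + ρ f`. -/
noncomputable def likelihood (ρ : ℝ) (f : Ω → ℝ) (m : ℕ) (X : Fin m → Ω) : ℝ :=
  ∏ j, (1 + ρ * f (X j))

theorem iidMass_pos {w : Ω → ℝ} (hw : ∀ x, 0 < w x) (m : ℕ) (X : Fin m → Ω) :
    0 < iidMass w m X :=
  Finset.prod_pos fun _ _ => hw _

theorem sum_iidMass_mul_prod [Fintype Ω] (w g : Ω → ℝ) (m : ℕ) :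
    ∑ X, iidMass w m X * ∏ j, g (X j) = (∑ x, w x * g x) ^ m := by
  rw [Fintype.sum_pow]
  exact Finset.sum_congr rfl fun X _ => Finset.prod_mul_distrib.symm

theorem sum_iidMass [Fintype Ω] {w : Ω → ℝ} (hw1 : ∑ x, w x = 1) (m : ℕ) :
    ∑ X, iidMass w m X = 1 := by
  simpa [hw1] using sum_iidMass_mul_prod w (fun _ => 1) m

theorem iidMass_mul_likelihood (w : Ω → ℝ) (ρ : ℝ) (f : Ω → ℝ) (m : ℕ) (X : Fin m → Ω) :
    iidMass w m X * likelihood ρ f m X = iidMass (fun x => w x * (1 + ρ * f x)) m X :=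
  Finset.prod_mul_distrib.symm

theorem inv_one_sub_sq_pow_le {ρ : ℝ} (h1 : ρ < 1) (h0 : 0 < ρ) {m : ℕ} (hq : m * ρ ^ 2 < 1) :
    ((1 - ρ ^ 2)⁻¹) ^ m ≤ (1 - m * ρ ^ 2)⁻¹ := by
  rw [inv_pow]
  refine inv_anti₀ (by linarith) ?_
  have := one_add_mul_le_pow (show -2 ≤ -ρ ^ 2 by nlinarith) m
  calc 1 - m * ρ ^ 2 = 1 + m * -ρ ^ 2 := by ring
    _ ≤ (1 + -ρ ^ 2) ^ m := this
    _ = _ := by ring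

theorem one_add_pow_le {a : ℝ} (ha : 0 ≤ a) {m : ℕ} (hq : m * a ≤ 1) :
    (1 + a) ^ m ≤ 1 + m * a + (m * a) ^ 2 := by
  have h1 : (1 + a) ^ m ≤ Real.exp (m * a) := by
    rw [Real.exp_nat_mul]
    exact pow_le_pow_left₀ (by linarith) (by linarith [Real.add_one_le_exp a]) m
  have h2 := (abs_le.1 (Real.abs_exp_sub_one_sub_id_le (x := m * a)
    (abs_le.2 ⟨by have : 0 ≤ m * a := by positivity
                  linarith, hq⟩))).2
  linarith

namespace IsUncorrelatedSigns

variable [Fintype Ω] {w : Ω → ℝ} {χ : ι → Ω → ℝ} {ρ : ℝ}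

/-- As χ² = 1, the powers and the inverse of 1 + ρ χ are affine in χ, so the constant term alone
gives each single-sample moment below. -/
theorem sum_affine (h : IsUncorrelatedSigns w χ) (i : ι) (a b : ℝ) :
    ∑ x, w x * (a + b * χ i x) = a := by
  have : ∀ x, w x * (a + b * χ i x) = a * w x + b * (w x * χ i x) := fun x => by ring
  simp_rw [this]
  rw [Finset.sum_add_distrib, ← Finset.mul_sum, ← Finset.mul_sum, h.weight_sum, h.mean_zero]
  ring

theorem abs_eq_one (h : IsUncorrelatedSigns w χ) (i : ι) (x : Ω) : |χ i x| = 1 :=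
  by rw [← Real.sqrt_sq_eq_abs, h.sq_eq_one, Real.sqrt_one]

theorem density_pos (h : IsUncorrelatedSigns w χ) (h0 : 0 < ρ) (h1 : ρ < 1) (i : ι) (x : Ω) :
    0 < 1 + ρ * χ i x := by
  have := neg_abs_le (χ i x)
  rw [h.abs_eq_one] at this
  nlinarith

theorem likelihood_pos (h : IsUncorrelatedSigns w χ) (h0 : 0 < ρ) (h1 : ρ < 1) (i : ι) (m : ℕ)
    (X : Fin m → Ω) : 0 < likelihood ρ (χ i) m X :=
  Finset.prod_pos fun _ _ => h.density_pos h0 h1 i _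

theorem sum_likelihood (h : IsUncorrelatedSigns w χ) (ρ : ℝ) (i : ι) (m : ℕ) :
    ∑ X, iidMass w m X * likelihood ρ (χ i) m X = 1 := by
  unfold likelihood
  rw [sum_iidMass_mul_prod w (fun x => 1 + ρ * χ i x), h.sum_affine, one_pow]

theorem sum_likelihood_sq (h : IsUncorrelatedSigns w χ) (ρ : ℝ) (i : ι) (m : ℕ) :
    ∑ X, iidMass w m X * likelihood ρ (χ i) m X ^ 2 = (1 + ρ ^ 2) ^ m := by
  unfold likelihood
  simp_rw [← Finset.prod_pow]
  rw [sum_iidMass_mul_prod w (fun x => (1 + ρ * χ i x) ^ 2), ← h.sum_affine i (1 + ρ ^ 2) (2 * ρ)]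
  congr 1
  refine Finset.sum_congr rfl fun x _ => ?_
  linear_combination w x * ρ ^ 2 * h.sq_eq_one i x

theorem sum_likelihood_cube (h : IsUncorrelatedSigns w χ) (ρ : ℝ) (i : ι) (m : ℕ) :
    ∑ X, iidMass w m X * likelihood ρ (χ i) m X ^ 3 = (1 + 3 * ρ ^ 2) ^ m := by
  unfold likelihood
  simp_rw [← Finset.prod_pow]
  rw [sum_iidMass_mul_prod w (fun x => (1 + ρ * χ i x) ^ 3),
    ← h.sum_affine i (1 + 3 * ρ ^ 2) (3 * ρ + ρ ^ 3)]
  congr 1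
  refine Finset.sum_congr rfl fun x _ => ?_
  linear_combination w x * (3 * ρ ^ 2 + ρ ^ 3 * χ i x) * h.sq_eq_one i x

theorem sum_inv_likelihood (h : IsUncorrelatedSigns w χ) (h0 : 0 < ρ) (h1 : ρ < 1) (i : ι)
    (m : ℕ) :
    ∑ X, iidMass w m X / likelihood ρ (χ i) m X = ((1 - ρ ^ 2)⁻¹) ^ m := by
  unfold likelihood
  simp_rw [div_eq_mul_inv, ← Finset.prod_inv_distrib]
  rw [sum_iidMass_mul_prod w (fun x => (1 + ρ * χ i x)⁻¹),
    ← h.sum_affine i (1 - ρ ^ 2)⁻¹ (-(1 - ρ ^ 2)⁻¹ * ρ)]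
  congr 1
  refine Finset.sum_congr rfl fun x _ => ?_
  have h2 := (h.density_pos h0 h1 i x).ne'
  have h3 : (1 - ρ ^ 2) ≠ 0 := by nlinarith
  field_simp
  linear_combination w x * ρ ^ 2 * h.sq_eq_one i x

theorem sum_likelihood_sub_one_sq (h : IsUncorrelatedSigns w χ) (ρ : ℝ) (i : ι) (m : ℕ) :
    ∑ X, iidMass w m X * (likelihood ρ (χ i) m X - 1) ^ 2 = (1 + ρ ^ 2) ^ m - 1 := by
  have : ∀ X, iidMass w m X * (likelihood ρ (χ i) m X - 1) ^ 2
      = iidMass w m X * likelihood ρ (χ i) m X ^ 2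
        - 2 * (iidMass w m X * likelihood ρ (χ i) m X) + iidMass w m X := fun X => by ring
  simp_rw [this]
  rw [Finset.sum_add_distrib, Finset.sum_sub_distrib, ← Finset.mul_sum, h.sum_likelihood_sq,
    h.sum_likelihood, sum_iidMass h.weight_sum]
  ring

/-- The exact second moment of the error in linearizing the likelihood ratio. -/
theorem sum_linearization_error_sq (h : IsUncorrelatedSigns w χ) (ρ : ℝ) (i : ι) (m : ℕ) :
    ∑ X, iidMass w m X * (likelihood ρ (χ i) m X - 1 - ρ * ∑ j, χ i (X j)) ^ 2
      = (1 + ρ ^ 2) ^ m - 1 - m * ρ ^ 2 := by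
  induction m with
  | zero => simp [likelihood]
  | succ m ih =>
    rw [← (Fin.consEquiv fun _ => Ω).sum_comp, Fintype.sum_prod_type_right]
    have step : ∀ Y : Fin m → Ω, ∑ x, iidMass w (m + 1) (Fin.consEquiv (fun _ => Ω) (x, Y)) *
        (likelihood ρ (χ i) (m + 1) (Fin.consEquiv (fun _ => Ω) (x, Y)) - 1
          - ρ * ∑ j, χ i (Fin.consEquiv (fun _ => Ω) (x, Y) j)) ^ 2
        = iidMass w m Y * (likelihood ρ (χ i) m Y - 1 - ρ * ∑ j, χ i (Y j)) ^ 2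
          + ρ ^ 2 * (iidMass w m Y * (likelihood ρ (χ i) m Y - 1) ^ 2) := by
      intro Y
      set e := likelihood ρ (χ i) m Y - 1 - ρ * ∑ j, χ i (Y j) with he
      set g := likelihood ρ (χ i) m Y - 1 with hg
      -- The new sample changes the error e to e + ρ χ g. The cross term averages to zero, as for
      -- martingale increments, and χ² = 1.
      rw [← h.sum_affine i (iidMass w m Y * e ^ 2 + ρ ^ 2 * (iidMass w m Y * g ^ 2))
        (iidMass w m Y * (2 * e * ρ * g))]
      refine Finset.sum_congr rfl fun x _ => ?_
      have e1 : iidMass w (m + 1) (Fin.consEquiv (fun _ => Ω) (x, Y)) = w x * iidMass w m Y := by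
        simp [iidMass, Fin.consEquiv, Fin.prod_univ_succ]
      have e2 : likelihood ρ (χ i) (m + 1) (Fin.consEquiv (fun _ => Ω) (x, Y)) - 1
          - ρ * ∑ j, χ i (Fin.consEquiv (fun _ => Ω) (x, Y) j) = e + ρ * χ i x * g := by
        simp only [likelihood, Fin.consEquiv, Fin.prod_univ_succ, Fin.sum_univ_succ, he, hg,
          Equiv.coe_fn_mk, Fin.cons_zero, Fin.cons_succ]
        ring
      rw [e1, e2]
      linear_combination w x * iidMass w m Y * ρ ^ 2 * g ^ 2 * h.sq_eq_one i x
    simp_rw [step]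
    rw [Finset.sum_add_distrib, ih, ← Finset.mul_sum, h.sum_likelihood_sub_one_sq]
    push_cast
    ring

/-- Expand (1 - L)⁴ / L into powers of L from L³ to 1/L. The coefficients of m ρ² cancel, 3 - 4 + 1
= 0, leaving order (m ρ²)² when m ρ² is small. -/
theorem sum_fourth_order_error (h : IsUncorrelatedSigns w χ) (h0 : 0 < ρ) (h1 : ρ < 1) (i : ι)
    (m : ℕ) :
    ∑ X, iidMass w m X * ((1 - likelihood ρ (χ i) m X) ^ 4 / likelihood ρ (χ i) m X)
      = (1 + 3 * ρ ^ 2) ^ m - 4 * (1 + ρ ^ 2) ^ m + 2 + ((1 - ρ ^ 2)⁻¹) ^ m := by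
  have : ∀ X, iidMass w m X * ((1 - likelihood ρ (χ i) m X) ^ 4 / likelihood ρ (χ i) m X)
      = iidMass w m X * likelihood ρ (χ i) m X ^ 3
        - 4 * (iidMass w m X * likelihood ρ (χ i) m X ^ 2)
        + 6 * (iidMass w m X * likelihood ρ (χ i) m X) - 4 * iidMass w m X
        + iidMass w m X / likelihood ρ (χ i) m X := fun X => by
    have := h.likelihood_pos h0 h1 i m X
    field_simp
    ring
  simp_rw [this]
  rw [Finset.sum_add_distrib, Finset.sum_sub_distrib, Finset.sum_add_distrib,
    Finset.sum_sub_distrib, ← Finset.mul_sum, ← Finset.mul_sum, ← Finset.mul_sum,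
    h.sum_likelihood_sq, h.sum_likelihood_cube, h.sum_inv_likelihood h0 h1, h.sum_likelihood,
    sum_iidMass h.weight_sum]
  ring

end IsUncorrelatedSigns

end SignFamilies

/-! ### Information carried by an s-bit summary of one batch -/

/-- Jensen's inequality for a conditional mean, from the tangent to exp at that mean. It turns a
moment generating function bound into a bound on conditional means. -/
theorem exp_mean_mul_le_sum_exp {α : Type*} (s : Finset α) {w z : α → ℝ} (hw : ∀ x ∈ s, 0 ≤ w x)
    (hp : 0 < ∑ x ∈ s, w x) :
    (∑ x ∈ s, w x) * Real.exp ((∑ x ∈ s, w x * z x) / ∑ x ∈ s, w x)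
      ≤ ∑ x ∈ s, w x * Real.exp (z x) := by
  set p := ∑ x ∈ s, w x with hpdef
  set z₀ := (∑ x ∈ s, w x * z x) / p with hz
  have hz' : ∑ x ∈ s, w x * z x = p * z₀ := by rw [hz]; field_simp
  calc p * Real.exp z₀ = ∑ x ∈ s, (w x * z x - w x * z₀ + w x) * Real.exp z₀ := by
        rw [← Finset.sum_mul, Finset.sum_add_distrib, Finset.sum_sub_distrib, ← Finset.sum_mul, hz',
          ← hpdef, sub_self, zero_add]
    _ ≤ ∑ x ∈ s, w x * Real.exp (z x) := by
        refine Finset.sum_le_sum fun x hx => ?_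
        have h1 : Real.exp (z x) = Real.exp (z x - z₀) * Real.exp z₀ := by
          rw [← Real.exp_add, sub_add_cancel]
        rw [h1, ← mul_assoc]
        refine mul_le_mul_of_nonneg_right ?_ (Real.exp_nonneg _)
        nlinarith [mul_le_mul_of_nonneg_left (Real.add_one_le_exp (z x - z₀)) (hw x hx)]

/-- The squared surprisal of an outcome of probability `p` in terms of `2 ^ s`. -/
theorem log_sq_le {p : ℝ} (hp : 0 < p) (hp1 : p ≤ 1) (s : ℕ) :
    Real.log p ^ 2 ≤ 2 * (s : ℝ) ^ 2 + 2 * ((2 ^ s)⁻¹ / p) := by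
  have hl0 : Real.log p ≤ 0 := Real.log_nonpos hp.le hp1
  set y := ((2 : ℝ) ^ s)⁻¹ / p with hy
  have hypos : 0 < y := by positivity
  have hlogy : Real.log y = -(s * Real.log 2) - Real.log p := by
    rw [hy, Real.log_div (by positivity) hp.ne', Real.log_inv, Real.log_pow]
  have h2 : Real.log 2 ≤ 1 := by linarith [Real.log_two_lt_d9]
  have hs : (s : ℝ) * Real.log 2 ≤ s := mul_le_of_le_one_right (Nat.cast_nonneg s) h2
  have hsq := Real.sq_sqrt hypos.le
  -- With x = y^(1/4): log y ≤ 4 (x - 1) ≤ x² = √y.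
  have h3 : Real.log y ≤ Real.sqrt y := by
    have h := Real.log_le_sub_one_of_pos (Real.sqrt_pos.2 (Real.sqrt_pos.2 hypos))
    have e1 : Real.log y = 4 * Real.log (Real.sqrt (Real.sqrt y)) := by
      rw [Real.log_sqrt (Real.sqrt_nonneg y), Real.log_sqrt hypos.le]
      ring
    have h4 := Real.sq_sqrt (Real.sqrt_nonneg y)
    nlinarith [sq_nonneg (Real.sqrt (Real.sqrt y) - 2)]
  have h5 : -Real.log p ≤ s + Real.sqrt y := by linarith
  have h6 : (-Real.log p) ^ 2 ≤ (s + Real.sqrt y) ^ 2 := pow_le_pow_left₀ (by linarith) h5 2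
  nlinarith [sq_nonneg ((s : ℝ) - Real.sqrt y)]

namespace IsUncorrelatedSigns

variable {Ω ι σ : Type*} [Fintype Ω] [Fintype ι] {w : Ω → ℝ} {χ : ι → Ω → ℝ} {ρ : ℝ}

theorem sum_linear_combination (h : IsUncorrelatedSigns w χ) (c : ι → ℝ) :
    ∑ x, w x * ∑ i, c i * χ i x = 0 := by
  simp_rw [Finset.mul_sum]
  rw [Finset.sum_comm]
  refine Finset.sum_eq_zero fun i _ => ?_
  rw [← mul_zero (c i), ← h.mean_zero i, Finset.mul_sum]
  exact Finset.sum_congr rfl fun x _ => by ring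

theorem sum_linear_combination_sq (h : IsUncorrelatedSigns w χ) (c : ι → ℝ) :
    ∑ x, w x * (∑ i, c i * χ i x) ^ 2 = ∑ i, c i ^ 2 := by
  classical
  have e : ∀ x, w x * (∑ i, c i * χ i x) ^ 2
      = ∑ i, ∑ j, c i * c j * (w x * (χ i x * χ j x)) := fun x => by
    rw [sq, Finset.sum_mul_sum, Finset.mul_sum]
    refine Finset.sum_congr rfl fun i _ => ?_
    rw [Finset.mul_sum]
    exact Finset.sum_congr rfl fun j _ => by ring
  simp_rw [e]
  rw [Finset.sum_comm]
  refine Finset.sum_congr rfl fun i _ => ?_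
  rw [Finset.sum_comm]
  simp_rw [← Finset.mul_sum]
  rw [Finset.sum_eq_single i (fun j _ hj => by rw [h.uncorrelated i j hj.symm, mul_zero])
    (fun hi => absurd (Finset.mem_univ i) hi)]
  simp_rw [← sq, h.sq_eq_one, mul_one]
  rw [h.weight_sum, mul_one]

theorem linear_combination_sq_le (h : IsUncorrelatedSigns w χ) (c : ι → ℝ) (x : Ω) :
    (∑ i, c i * χ i x) ^ 2 ≤ Fintype.card ι * ∑ i, c i ^ 2 := by
  refine (Finset.sum_mul_sq_le_sq_mul_sq _ _ _).trans_eq ?_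
  simp_rw [h.sq_eq_one]
  simp [mul_comm]

/-- A subgaussian bound, in the range where the exponent is bounded, for the moment generating
function of a linear combination of empirical correlations. -/
theorem sum_exp_linear_combination_le (h : IsUncorrelatedSigns w χ) (c : ι → ℝ) {θ : ℝ}
    (hθ : θ ^ 2 * (Fintype.card ι * ∑ i, c i ^ 2) ≤ 1) (m : ℕ) :
    ∑ X, iidMass w m X * Real.exp (θ * ∑ j, ∑ i, c i * χ i (X j))
      ≤ Real.exp (m * (θ ^ 2 * ∑ i, c i ^ 2)) := by
  have e : ∀ X : Fin m → Ω, Real.exp (θ * ∑ j, ∑ i, c i * χ i (X j))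
      = ∏ j, Real.exp (θ * ∑ i, c i * χ i (X j)) := fun X => by
    rw [Finset.mul_sum, Real.exp_sum]
  simp_rw [e]
  rw [sum_iidMass_mul_prod w (fun x => Real.exp (θ * ∑ i, c i * χ i x)), Real.exp_nat_mul]
  refine pow_le_pow_left₀ (Finset.sum_nonneg fun x _ =>
    mul_nonneg (h.weight_pos x).le (Real.exp_nonneg _)) ?_ m
  have hx : ∀ x, w x * Real.exp (θ * ∑ i, c i * χ i x)
      ≤ w x + θ * (w x * ∑ i, c i * χ i x) + θ ^ 2 * (w x * (∑ i, c i * χ i x) ^ 2) := by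
    intro x
    have hb : |θ * ∑ i, c i * χ i x| ≤ 1 := by
      rw [← sq_le_one_iff_abs_le_one, mul_pow]
      exact (mul_le_mul_of_nonneg_left (h.linear_combination_sq_le c x) (sq_nonneg θ)).trans hθ
    have := mul_le_mul_of_nonneg_left (abs_le.1 (Real.abs_exp_sub_one_sub_id_le hb)).2
      (h.weight_pos x).le
    nlinarith
  refine (Finset.sum_le_sum fun x _ => hx x).trans ?_
  rw [Finset.sum_add_distrib, Finset.sum_add_distrib, ← Finset.mul_sum, ← Finset.mul_sum,
    h.weight_sum, h.sum_linear_combination, h.sum_linear_combination_sq, mul_zero, add_zero]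
  linarith [Real.add_one_le_exp (θ ^ 2 * ∑ i, c i ^ 2)]

variable [DecidableEq σ]

/-- Conditioning on an event of probability `p` biases the empirical correlations by a vector whose
squared length is of order at most the squared logarithm of `p`. -/
theorem sum_sq_conditional_mean_le (h : IsUncorrelatedSigns w χ) {m s : ℕ} (hs : 0 < s)
    (hm : m = Fintype.card ι * s) (hm0 : 0 < m) (F : (Fin m → Ω) → σ) (u : σ)
    (hp : 0 < pushMass F (iidMass w m) u) :
    ∑ i, (pushMass F (fun X => iidMass w m X * ∑ j, χ i (X j)) u / pushMass F (iidMass w m) u) ^ 2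
      ≤ m * (4 * s + 4 * Real.log (pushMass F (iidMass w m) u) ^ 2 / s) := by
  set p := pushMass F (iidMass w m) u with hpdef
  set c : ι → ℝ := fun i => pushMass F (fun X => iidMass w m X * ∑ j, χ i (X j)) u / p with hc
  change ∑ i, c i ^ 2 ≤ _
  set N := ∑ i, c i ^ 2 with hN
  have hs' : (0 : ℝ) < s := Nat.cast_pos.2 hs
  have hm' : (0 : ℝ) < m := Nat.cast_pos.2 hm0
  have hmK : (m : ℝ) = Fintype.card ι * s := by rw [hm]; push_cast; ring
  set K : ℝ := (Fintype.card ι : ℝ) with hKdef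
  have hK : 0 < K := by
    by_contra hneg
    nlinarith
  -- Otherwise K N > 4 m K s = 4 m², so √(K N) > 2 m and the quadratic term of the exponent costs
  -- less than half the linear gain.
  rcases le_or_gt N (m * (4 * s)) with hle | hgt
  · refine hle.trans (mul_le_mul_of_nonneg_left ?_ hm'.le)
    have : 0 ≤ 4 * Real.log p ^ 2 / s := by positivity
    linarith
  have hNpos : 0 < N := lt_trans (by positivity) hgt
  -- θ = 1/R is the largest parameter for which the Cauchy–Schwarz bound keeps the single-sample
  -- exponent at most 1.
  set R := Real.sqrt (K * N) with hR
  have hKN : 0 < K * N := by positivity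
  have hRpos : 0 < R := Real.sqrt_pos.2 hKN
  have hR2 : R ^ 2 = K * N := Real.sq_sqrt hKN.le
  have hR2m : 2 * m < R := by
    refine lt_of_pow_lt_pow_left₀ 2 hRpos.le ?_
    rw [hR2]
    nlinarith [mul_lt_mul_of_pos_left hgt hK]
  have hmgf := h.sum_exp_linear_combination_le c (θ := R⁻¹)
    (by rw [← hKdef, ← hN, ← hR2, inv_pow, inv_mul_cancel₀ (by positivity)]) m
  rw [← hN] at hmgf
  have hjen := exp_mean_mul_le_sum_exp (Finset.univ.filter fun X => F X = u) (w := iidMass w m)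
    (z := fun X => R⁻¹ * ∑ j, ∑ i, c i * χ i (X j))
    (fun X _ => (iidMass_pos h.weight_pos m X).le) hp
  have hmean : (∑ X with F X = u, iidMass w m X * (R⁻¹ * ∑ j, ∑ i, c i * χ i (X j)))
      / ∑ X with F X = u, iidMass w m X = R⁻¹ * N := by
    have e1 : ∀ X : Fin m → Ω, iidMass w m X * (R⁻¹ * ∑ j, ∑ i, c i * χ i (X j))
        = R⁻¹ * ∑ i, c i * (iidMass w m X * ∑ j, χ i (X j)) := fun X => by
      rw [Finset.sum_comm, mul_left_comm, Finset.mul_sum]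
      congr 1
      refine Finset.sum_congr rfl fun i _ => ?_
      rw [← Finset.mul_sum]
      ring
    simp_rw [e1]
    rw [← Finset.mul_sum, Finset.sum_comm]
    simp_rw [← Finset.mul_sum]
    change R⁻¹ * (∑ i, c i * pushMass F (fun X => iidMass w m X * ∑ j, χ i (X j)) u) / p = _
    rw [mul_div_assoc, Finset.sum_div, hN]
    congr 1
    refine Finset.sum_congr rfl fun i _ => ?_
    rw [mul_div_assoc, sq]
  rw [hmean] at hjen
  have hsub : ∑ X with F X = u, iidMass w m X * Real.exp (R⁻¹ * ∑ j, ∑ i, c i * χ i (X j))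
      ≤ ∑ X, iidMass w m X * Real.exp (R⁻¹ * ∑ j, ∑ i, c i * χ i (X j)) :=
    Finset.sum_le_sum_of_subset_of_nonneg (Finset.filter_subset _ _) fun X _ _ =>
      mul_nonneg (iidMass_pos h.weight_pos m X).le (Real.exp_nonneg _)
  have hfin := (hjen.trans hsub).trans hmgf
  change p * _ ≤ _ at hfin
  have hlog := Real.log_le_log (by positivity) hfin
  rw [Real.log_mul hp.ne' (Real.exp_ne_zero _), Real.log_exp, Real.log_exp] at hlog
  have h1 : R * (R⁻¹ * N) = N := by field_simp
  have h2 : R * (m * (R⁻¹ ^ 2 * N)) * R = m * N := by field_simp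
  have h3 : N * R ≤ -Real.log p * (R * R) + m * N := by
    have := mul_le_mul_of_nonneg_right (mul_le_mul_of_nonneg_left hlog hRpos.le) hRpos.le
    nlinarith
  have h4 : N * R ≤ 2 * (-Real.log p) * (K * N) := by
    rw [← sq, hR2] at h3
    linarith [mul_lt_mul_of_pos_left hR2m hNpos]
  have h5 : R ≤ 2 * (-Real.log p) * K := by
    refine le_of_mul_le_mul_left ?_ hNpos
    linarith
  have h6 : K * N ≤ (2 * (-Real.log p) * K) ^ 2 := by
    rw [← hR2]
    exact pow_le_pow_left₀ hRpos.le h5 2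
  have h7 : N ≤ 4 * K * Real.log p ^ 2 := by
    refine le_of_mul_le_mul_left ?_ hK
    linarith
  calc N ≤ 4 * K * Real.log p ^ 2 := h7
    _ = m * (4 * Real.log p ^ 2 / s) := by
        rw [hmK]
        field_simp
    _ ≤ _ := mul_le_mul_of_nonneg_left (by linarith) hm'.le

/-- The total information, to first order, that a summary of `s` bits carries on the empirical
correlations of a batch. -/
theorem sum_first_order_le [Fintype σ] (h : IsUncorrelatedSigns w χ) {m s : ℕ} (hs : 0 < s)
    (hm : m = Fintype.card ι * s) (hm0 : 0 < m) (hσ : Fintype.card σ = 2 ^ s)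
    (F : (Fin m → Ω) → σ) :
    ∑ i, ∑ u, (pushMass F (fun X => iidMass w m X * ∑ j, χ i (X j)) u) ^ 2
      / pushMass F (iidMass w m) u ≤ 20 * s * m := by
  have hW : ∀ X : Fin m → Ω, 0 ≤ iidMass w m X := fun X => (iidMass_pos h.weight_pos m X).le
  have hs' : (1 : ℝ) ≤ s := by exact_mod_cast hs
  have hsum1 : ∑ u, pushMass F (iidMass w m) u = 1 := by
    rw [sum_pushMass, sum_iidMass h.weight_sum]
  rw [Finset.sum_comm]
  have key : ∀ u, ∑ i, (pushMass F (fun X => iidMass w m X * ∑ j, χ i (X j)) u) ^ 2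
      / pushMass F (iidMass w m) u
      ≤ m * (12 * s) * pushMass F (iidMass w m) u + m * 8 * ((2 : ℝ) ^ s)⁻¹ := by
    intro u
    rcases (pushMass_nonneg F hW u).eq_or_lt with h0 | hp
    · rw [← h0]
      simp only [div_zero, Finset.sum_const_zero, mul_zero, zero_add]
      positivity
    have h1 := h.sum_sq_conditional_mean_le hs hm hm0 F u hp
    have hp1 : pushMass F (iidMass w m) u ≤ 1 := by
      rw [← hsum1]
      exact Finset.single_le_sum (fun v _ => pushMass_nonneg F hW v) (Finset.mem_univ u)
    have h2 := log_sq_le hp hp1 s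
    set p := pushMass F (iidMass w m) u
    have e : ∑ i, (pushMass F (fun X => iidMass w m X * ∑ j, χ i (X j)) u) ^ 2 / p
        = p * ∑ i, (pushMass F (fun X => iidMass w m X * ∑ j, χ i (X j)) u / p) ^ 2 := by
      rw [Finset.mul_sum]
      refine Finset.sum_congr rfl fun i _ => ?_
      field_simp
    rw [e]
    -- Weighted by p, the last term is the constant 8 · 2^(-s); over 2^s states it adds up to 8.
    have h3 : 4 * (s : ℝ) + 4 * Real.log p ^ 2 / s ≤ 12 * s + 8 * (((2 : ℝ) ^ s)⁻¹ / p) := by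
      have hy : 0 ≤ ((2 : ℝ) ^ s)⁻¹ / p := by positivity
      have : 4 * Real.log p ^ 2 / s ≤ 8 * s + 8 * (((2 : ℝ) ^ s)⁻¹ / p) := by
        rw [div_le_iff₀ (by linarith)]
        nlinarith
      linarith
    calc _ ≤ p * (m * (12 * s + 8 * (((2 : ℝ) ^ s)⁻¹ / p))) :=
          mul_le_mul_of_nonneg_left
            (h1.trans (mul_le_mul_of_nonneg_left h3 (Nat.cast_nonneg m))) hp.le
      _ = _ := by field_simp
  refine (Finset.sum_le_sum fun u _ => key u).trans ?_
  rw [Finset.sum_add_distrib, ← Finset.mul_sum, hsum1, Finset.sum_const, Finset.card_univ, hσ,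
    nsmul_eq_mul]
  push_cast
  have e : (2 : ℝ) ^ s * (m * 8 * ((2 : ℝ) ^ s)⁻¹) = m * 8 := by field_simp
  rw [e]
  nlinarith [Nat.cast_nonneg (α := ℝ) m]

/-- A summary of `s` bits of a batch of `m` samples reveals, in total over the family, at most
`O(s m ρ²)` of information. -/
theorem sum_relEntropy_batch_le [Fintype σ] (h : IsUncorrelatedSigns w χ) (h0 : 0 < ρ) (h1 : ρ < 1)
    {m s : ℕ} (hs : 0 < s) (hm : m = Fintype.card ι * s) (hm0 : 0 < m)
    (hσ : Fintype.card σ = 2 ^ s) (hρ : ρ * Fintype.card ι ≤ 1) (hq : m * ρ ^ 2 ≤ 1 / 10)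
    (F : (Fin m → Ω) → σ) :
    ∑ i, relEntropy (pushMass F (iidMass w m))
      (pushMass F (iidMass (fun x => w x * (1 + ρ * χ i x)) m)) ≤ 95 * s * (m * ρ ^ 2) := by
  have hW := iidMass_pos h.weight_pos m
  have hfirst := h.sum_first_order_le hs hm hm0 hσ F
  have hq0 : 0 ≤ m * ρ ^ 2 := by positivity
  -- 15 = 4 + 11: the linearization error is at most (m ρ²)² and enters with factor 4; the
  -- fourth-order error is at most 11 (m ρ²)².
  have hi : ∀ i, relEntropy (pushMass F (iidMass w m))
      (pushMass F (iidMass (fun x => w x * (1 + ρ * χ i x)) m))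
      ≤ 4 * ρ ^ 2 * ∑ u, (pushMass F (fun X => iidMass w m X * ∑ j, χ i (X j)) u) ^ 2
          / pushMass F (iidMass w m) u + 15 * (m * ρ ^ 2) ^ 2 := by
    intro i
    have hquad := relEntropy_pushMass_le_quadratic F hW (h.likelihood_pos h0 h1 i m)
      (by rw [h.sum_likelihood, sum_iidMass h.weight_sum])
    rw [funext (iidMass_mul_likelihood w ρ (χ i) m), h.sum_fourth_order_error h0 h1] at hquad
    have hpow1 := one_add_pow_le (a := 3 * ρ ^ 2) (by positivity) (m := m) (by linarith)
    have hpow2 := one_add_pow_le (a := ρ ^ 2) (by positivity) (m := m) (by linarith)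
    have hpow3 := one_add_mul_le_pow (show -2 ≤ ρ ^ 2 by nlinarith) m
    have hpow4 := inv_one_sub_sq_pow_le h1 h0 (m := m) (by linarith)
    have hinv : (1 - m * ρ ^ 2)⁻¹ ≤ 1 + m * ρ ^ 2 + 2 * (m * ρ ^ 2) ^ 2 := by
      rw [inv_le_iff_one_le_mul₀ (by linarith)]
      nlinarith [mul_nonneg (sq_nonneg (m * ρ ^ 2)) hq0]
    have hlin := h.sum_linearization_error_sq ρ i m
    have hu : ∀ u, (pushMass F (fun X => iidMass w m X * (likelihood ρ (χ i) m X - 1)) u) ^ 2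
        / pushMass F (iidMass w m) u
        ≤ 2 * ρ ^ 2 * ((pushMass F (fun X => iidMass w m X * ∑ j, χ i (X j)) u) ^ 2
          / pushMass F (iidMass w m) u) + 2 * pushMass F (fun X => iidMass w m X *
            (likelihood ρ (χ i) m X - 1 - ρ * ∑ j, χ i (X j)) ^ 2) u := by
      intro u
      have hp := pushMass_nonneg F (fun X => (hW X).le) u
      have hE : (pushMass F (fun X => iidMass w m X *
          (likelihood ρ (χ i) m X - 1 - ρ * ∑ j, χ i (X j))) u) ^ 2 / pushMass F (iidMass w m) u
          ≤ pushMass F (fun X => iidMass w m X *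
            (likelihood ρ (χ i) m X - 1 - ρ * ∑ j, χ i (X j)) ^ 2) u := by
        refine (Finset.sq_sum_div_le_sum_sq_div _ _
          fun X _ => hW X).trans_eq (Finset.sum_congr rfl fun X _ => ?_)
        have := hW X
        field_simp
      have hsplit : pushMass F (fun X => iidMass w m X * (likelihood ρ (χ i) m X - 1)) u
          = ρ * pushMass F (fun X => iidMass w m X * ∑ j, χ i (X j)) u
            + pushMass F (fun X => iidMass w m X *
              (likelihood ρ (χ i) m X - 1 - ρ * ∑ j, χ i (X j))) u := by
        unfold pushMass
        rw [Finset.mul_sum, ← Finset.sum_add_distrib]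
        exact Finset.sum_congr rfl fun X _ => by ring
      rw [hsplit]
      set a := pushMass F (fun X => iidMass w m X * ∑ j, χ i (X j)) u
      set b := pushMass F (fun X => iidMass w m X *
              (likelihood ρ (χ i) m X - 1 - ρ * ∑ j, χ i (X j))) u
      set p := pushMass F (iidMass w m) u
      have hab : (ρ * a + b) ^ 2 / p ≤ (2 * ρ ^ 2 * a ^ 2 + 2 * b ^ 2) / p :=
        div_le_div_of_nonneg_right (by nlinarith [sq_nonneg (ρ * a - b)]) hp
      have e : (2 * ρ ^ 2 * a ^ 2 + 2 * b ^ 2) / p = 2 * ρ ^ 2 * (a ^ 2 / p) + 2 * (b ^ 2 / p) := by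
        ring
      linarith
    have hsumu := Finset.sum_le_sum fun u (_ : u ∈ Finset.univ) => hu u
    rw [Finset.sum_add_distrib, ← Finset.mul_sum, ← Finset.mul_sum, sum_pushMass, hlin] at hsumu
    linarith
  refine (Finset.sum_le_sum fun i _ => hi i).trans ?_
  rw [Finset.sum_add_distrib, ← Finset.mul_sum, Finset.sum_const, Finset.card_univ, nsmul_eq_mul]
  have hmK : (m : ℝ) = Fintype.card ι * s := by rw [hm]; push_cast; ring
  set K : ℝ := (Fintype.card ι : ℝ)
  have hK0 : 0 ≤ K := Nat.cast_nonneg _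
  have h2 : (ρ * K) ^ 2 ≤ 1 := pow_le_one₀ (by positivity) hρ
  -- Here K m ρ² = s (ρ K)² ≤ s, so K copies of 15 (m ρ²)² cost at most 15 s m ρ². With 4 · 20 from
  -- the first-order term this makes 95.
  have h3 : K * (m * ρ ^ 2) ≤ s := by
    rw [hmK]
    nlinarith [Nat.cast_nonneg (α := ℝ) s]
  have h4 := mul_le_mul_of_nonneg_right h3 hq0
  have h5 := mul_le_mul_of_nonneg_left hfirst (show 0 ≤ 4 * ρ ^ 2 by positivity)
  nlinarith

end IsUncorrelatedSigns

/-! ### Laws of the memory state along the stream -/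

section StateLaw

variable {Ω σ : Type*} [Fintype Ω] [DecidableEq σ]

/-- The law of the state after `n` steps of the state machine `f`, started at time `k` in the state
`u₀` and driven by independent samples from `w`. -/
noncomputable def stateLaw (f : ℕ → Ω → σ → σ) (w : Ω → ℝ) (k n : ℕ) (u₀ : σ) : σ → ℝ :=
  pushMass (fun X : Fin n → Ω => Fin.foldl n (fun v j => f (k + j) (X j) v) u₀) (iidMass w n)

variable (f : ℕ → Ω → σ → σ)

theorem stateLaw_nonneg {w : Ω → ℝ} (hw : ∀ x, 0 < w x) (k n : ℕ) (u₀ v : σ) :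
    0 ≤ stateLaw f w k n u₀ v :=
  pushMass_nonneg _ (fun X => (iidMass_pos hw n X).le) v

theorem sum_stateLaw [Fintype σ] {w : Ω → ℝ} (hw : ∑ x, w x = 1) (k n : ℕ) (u₀ : σ) :
    ∑ v, stateLaw f w k n u₀ v = 1 :=
  (sum_pushMass _ _).trans (sum_iidMass hw n)

theorem stateLaw_pos_of_ne_zero {w w' : Ω → ℝ} (hw' : ∀ x, 0 < w' x) (k n : ℕ) (u₀ v : σ)
    (h : stateLaw f w k n u₀ v ≠ 0) : 0 < stateLaw f w' k n u₀ v :=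
  pushMass_pos_of_pos _ (iidMass_pos hw' n) h

/-- The Chapman–Kolmogorov equation. -/
theorem stateLaw_add [Fintype σ] (w : Ω → ℝ) (k n m : ℕ) (u₀ v : σ) :
    stateLaw f w k (n + m) u₀ v
      = ∑ u, stateLaw f w k n u₀ u * stateLaw f w (k + n) m u v := by
  have hfold : ∀ (X : Fin n → Ω) (Y : Fin m → Ω),
      Fin.foldl (n + m) (fun v j => f (k + j) (Fin.append X Y j) v) u₀
        = Fin.foldl m (fun v j => f (k + n + j) (Y j) v)
          (Fin.foldl n (fun v j => f (k + j) (X j) v) u₀) := fun X Y => by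
    rw [Fin.foldl_add]
    congr 1
    · funext v j
      rw [Fin.append_right, Fin.val_natAdd, add_assoc]
    · congr 1
      funext v j
      exact congrArg (fun y => f (k + j) y v) (Fin.append_left X Y j)
  have hmass : ∀ (X : Fin n → Ω) (Y : Fin m → Ω),
      iidMass w (n + m) (Fin.append X Y) = iidMass w n X * iidMass w m Y := fun X Y => by
    simp [iidMass, Fin.prod_univ_add]
  unfold stateLaw pushMass
  simp_rw [Finset.sum_filter]
  rw [← (Fin.appendEquiv n m).sum_comp, Fintype.sum_prod_type]
  have hL : ∀ (X : Fin n → Ω), ∑ Y : Fin m → Ω,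
      (if Fin.foldl (n + m) (fun v j => f (k + j) (Fin.appendEquiv n m (X, Y) j) v) u₀ = v
        then iidMass w (n + m) (Fin.appendEquiv n m (X, Y)) else 0)
      = ∑ u, (if Fin.foldl n (fun v j => f (k + j) (X j) v) u₀ = u then iidMass w n X else 0)
        * ∑ Y : Fin m → Ω, (if Fin.foldl m (fun v j => f (k + n + j) (Y j) v) u = v
          then iidMass w m Y else 0) := fun X => by
    simp_rw [ite_mul, zero_mul]
    rw [Finset.sum_ite_eq, if_pos (Finset.mem_univ _), Finset.mul_sum]
    refine Finset.sum_congr rfl fun Y _ => ?_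
    change (if Fin.foldl (n + m) (fun v j => f (k + j) (Fin.append X Y j) v) u₀ = v
      then iidMass w (n + m) (Fin.append X Y) else 0) = _
    rw [hfold, hmass, mul_ite, mul_zero]
  simp_rw [hL]
  rw [Finset.sum_comm]
  simp_rw [← Finset.sum_mul]

theorem stateLaw_zero (w : Ω → ℝ) (k : ℕ) (u₀ v : σ) :
    stateLaw f w k 0 u₀ v = if u₀ = v then 1 else 0 := by
  unfold stateLaw pushMass iidMass
  simp only [Fin.foldl_zero, Finset.sum_filter]
  simp

/-- Idle steps do not change the law. -/
theorem stateLaw_add_of_idle [Fintype σ] {w : Ω → ℝ} (hw : ∑ x, w x = 1) (k n m : ℕ)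
    (hf : ∀ j x v, k + n ≤ j → f j x v = v) (u₀ v : σ) :
    stateLaw f w k (n + m) u₀ v = stateLaw f w k n u₀ v := by
  have hidle : ∀ u, stateLaw f w (k + n) m u v = if u = v then 1 else 0 := fun u => by
    have hfold : ∀ X : Fin m → Ω, Fin.foldl m (fun v j => f (k + n + j) (X j) v) u = u := fun X => by
      have : (fun v (j : Fin m) => f (k + n + j) (X j) v) = fun v _ => v := by
        funext v j
        exact hf _ _ _ (Nat.le_add_right _ _)
      rw [this]
      clear hf this X
      induction m with
      | zero => rfl
      | succ m ih => rw [Fin.foldl_succ, ih]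
    unfold stateLaw pushMass
    simp_rw [hfold, Finset.sum_filter]
    split_ifs
    · exact sum_iidMass hw m
    · exact Finset.sum_const_zero
  rw [stateLaw_add]
  simp [hidle]

variable {ι : Type*} [Fintype ι] [Fintype σ]

/-- The total relative entropy of the state laws grows at most linearly in the number of batches. -/
theorem sum_relEntropy_stateLaw_le {w : Ω → ℝ} {w' : ι → Ω → ℝ} (hw : ∀ x, 0 < w x)
    (hw1 : ∑ x, w x = 1) (hw' : ∀ i x, 0 < w' i x) {m : ℕ} {B : ℝ}
    (hB : ∀ F : (Fin m → Ω) → σ,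
      ∑ i, relEntropy (pushMass F (iidMass w m)) (pushMass F (iidMass (w' i) m)) ≤ B)
    (u₀ : σ) (T : ℕ) :
    ∑ i, relEntropy (stateLaw f w 0 (T * m) u₀) (stateLaw f (w' i) 0 (T * m) u₀) ≤ T * B := by
  induction T with
  | zero =>
    refine (Finset.sum_eq_zero fun i _ => ?_).trans_le (by simp)
    refine Finset.sum_eq_zero fun u _ => ?_
    rw [zero_mul, stateLaw_zero, stateLaw_zero]
    split_ifs <;> simp
  | succ T ih =>
    have hstep : ∀ i, relEntropy (stateLaw f w 0 ((T + 1) * m) u₀)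
        (stateLaw f (w' i) 0 ((T + 1) * m) u₀)
        ≤ relEntropy (stateLaw f w 0 (T * m) u₀) (stateLaw f (w' i) 0 (T * m) u₀)
          + ∑ u, stateLaw f w 0 (T * m) u₀ u
            * relEntropy (stateLaw f w (0 + T * m) m u) (stateLaw f (w' i) (0 + T * m) m u) := by
      intro i
      rw [Nat.succ_mul, funext (stateLaw_add f w 0 (T * m) m u₀),
        funext (stateLaw_add f (w' i) 0 (T * m) m u₀)]
      exact relEntropy_comp_le (stateLaw_nonneg f hw _ _ _) (stateLaw_nonneg f (hw' i) _ _ _)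
        (stateLaw_pos_of_ne_zero f (hw' i) _ _ _) (fun u => stateLaw_nonneg f hw _ _ u)
        (fun u => stateLaw_nonneg f (hw' i) _ _ u)
        (fun u => stateLaw_pos_of_ne_zero f (hw' i) _ _ u) fun u => sum_stateLaw f hw1 _ _ u
    refine (Finset.sum_le_sum fun i _ => hstep i).trans ?_
    rw [Finset.sum_add_distrib, Finset.sum_comm]
    simp_rw [← Finset.mul_sum]
    -- The weights are null probabilities, the same for all i, so `hB` applies to the batch map
    -- started from each state u.
    have h2 := Finset.sum_le_sum fun u (_ : u ∈ Finset.univ) =>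
      mul_le_mul_of_nonneg_left (hB fun X : Fin m → Ω =>
        Fin.foldl m (fun v j => f (0 + T * m + j) (X j) v) u)
        (stateLaw_nonneg f hw 0 (T * m) u₀ u)
    rw [← Finset.sum_mul, sum_stateLaw f hw1, one_mul] at h2
    push_cast
    unfold stateLaw at h2 ih ⊢
    linarith

end StateLaw

/-! ### From identification to the tradeoff -/

namespace StreamingAlgorithm

variable {Ω ι : Type*} {t s : ℕ}

/-- The steps of the algorithm, continued by idle steps. -/
def paddedStep (A : StreamingAlgorithm Ω ι t s) (j : ℕ) (x : Ω) (u : Fin s → Bool) :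
    Fin s → Bool :=
  if h : j < t then A.step ⟨j, h⟩ x u else u

theorem outputProb_eq [Fintype Ω] [DecidableEq ι] (A : StreamingAlgorithm Ω ι t s) (p : Ω → ℝ)
    (i : ι) : A.outputProb p i = ∑ u with A.output u = i, stateLaw A.paddedStep p 0 t A.init u := by
  have hfold : ∀ X : Fin t → Ω,
      Fin.foldl t (fun v j => A.paddedStep (0 + j) (X j) v) A.init = A.finalState X := fun X => by
    unfold finalState
    congr 1
    funext v j
    simp [paddedStep]
  unfold outputProb stateLaw pushMass iidMass run
  simp_rw [hfold, Finset.sum_filter]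
  have hR : ∀ u, (if A.output u = i then ∑ X : Fin t → Ω,
      (if A.finalState X = u then ∏ j, p (X j) else 0) else 0)
      = ∑ X : Fin t → Ω, if A.finalState X = u then
        (if A.output u = i then ∏ j, p (X j) else 0) else 0 := fun u => by
    split_ifs <;> simp
  simp_rw [hR]
  rw [Finset.sum_comm]
  simp

variable [Fintype Ω] [Fintype ι] [DecidableEq ι] {w : Ω → ℝ} {χ : ι → Ω → ℝ} {ρ : ℝ}

/-- The law of the final memory of an identifying algorithm has large relative entropies. -/
theorem Identifies.le_sum_relEntropy {A : StreamingAlgorithm Ω ι t s}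
    (h : IsUncorrelatedSigns w χ) (h0 : 0 < ρ) (h1 : ρ < 1) (hK : 3 ≤ Fintype.card ι)
    (hA : A.Identifies (fun i x => w x * (1 + ρ * χ i x)) (1 / 3)) :
    (Fintype.card ι : ℝ) / 10 ≤ ∑ i, relEntropy (stateLaw A.paddedStep w 0 t A.init)
      (stateLaw A.paddedStep (fun x => w x * (1 + ρ * χ i x)) 0 t A.init) := by
  have hpos : ∀ i x, 0 < w x * (1 + ρ * χ i x) := fun i x =>
    mul_pos (h.weight_pos x) (h.density_pos h0 h1 i x)
  have hi : ∀ i, 1 / 3 - 7 / 10 * A.outputProb w i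
      ≤ relEntropy (stateLaw A.paddedStep w 0 t A.init)
      (stateLaw A.paddedStep (fun x => w x * (1 + ρ * χ i x)) 0 t A.init) := by
    intro i
    rw [A.outputProb_eq]
    refine relEntropy_ge_of_event (stateLaw_nonneg _ h.weight_pos _ _ _)
      (stateLaw_nonneg _ (hpos i) _ _ _) (stateLaw_pos_of_ne_zero _ (hpos i) _ _ _)
      (sum_stateLaw _ h.weight_sum _ _ _) (sum_stateLaw _ (h.sum_affine i 1 ρ) _ _ _) _ ?_
    rw [← A.outputProb_eq]
    linarith [hA i]
  have hout : ∑ i, A.outputProb w i = 1 :=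
    (Finset.sum_fiberwise _ _ _).trans (sum_iidMass h.weight_sum t)
  refine le_trans ?_ (Finset.sum_le_sum fun i _ => hi i)
  rw [Finset.sum_sub_distrib, ← Finset.mul_sum, hout, Finset.sum_const, Finset.card_univ,
    nsmul_eq_mul]
  -- K/3 - 7/10 ≥ K/10 holds exactly when K ≥ 3.
  have : (3 : ℝ) ≤ Fintype.card ι := by exact_mod_cast hK
  linarith

/-- The sample complexity bound that holds irrespective of the memory. -/
theorem Identifies.le_samples {A : StreamingAlgorithm Ω ι t s}
    (h : IsUncorrelatedSigns w χ) (h0 : 0 < ρ) (h1 : ρ < 1) (hK : 3 ≤ Fintype.card ι)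
    (hA : A.Identifies (fun i x => w x * (1 + ρ * χ i x)) (1 / 3)) :
    1 / 20 ≤ t * ρ ^ 2 := by
  by_contra! hlt
  have hsum := hA.le_sum_relEntropy h h0 h1 hK
  -- The χ²-divergence is at most 20/19 - 1 = 1/19, below the average 1/10 that identification
  -- forces.
  have hi : ∀ i, relEntropy (stateLaw A.paddedStep w 0 t A.init)
      (stateLaw A.paddedStep (fun x => w x * (1 + ρ * χ i x)) 0 t A.init) ≤ 1 / 19 := by
    intro i
    have h2 := relEntropy_pushMass_le_sum_div
      (fun X : Fin t → Ω => Fin.foldl t (fun v j => A.paddedStep (0 + j) (X j) v) A.init)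
      (iidMass_pos h.weight_pos t) (h.likelihood_pos h0 h1 i t)
    rw [h.sum_inv_likelihood h0 h1, sum_iidMass h.weight_sum,
      funext (iidMass_mul_likelihood w ρ (χ i) t)] at h2
    have h3 := inv_one_sub_sq_pow_le h1 h0 (m := t) (by linarith)
    have h4 : (1 - t * ρ ^ 2)⁻¹ ≤ (19 / 20 : ℝ)⁻¹ := inv_anti₀ (by norm_num) (by linarith)
    norm_num at h4
    unfold stateLaw
    linarith
  have h2 := Finset.sum_le_sum fun i (_ : i ∈ Finset.univ) => hi i
  rw [Finset.sum_const, Finset.card_univ, nsmul_eq_mul] at h2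
  have : (3 : ℝ) ≤ Fintype.card ι := by exact_mod_cast hK
  linarith

/-- The memory-sample tradeoff for identifying a weakly correlated sign function out of an
uncorrelated family. -/
theorem Identifies.card_le_mul {A : StreamingAlgorithm Ω ι t s}
    (h : IsUncorrelatedSigns w χ) (h0 : 0 < ρ) (h1 : ρ < 1) (hs : 1 ≤ s)
    (hK : 3 ≤ Fintype.card ι) (hρ : ρ * Fintype.card ι ≤ 1)
    (hA : A.Identifies (fun i x => w x * (1 + ρ * χ i x)) (1 / 3)) :
    (Fintype.card ι : ℝ) ≤ 1900 * ρ ^ 2 * (t * s) := by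
  have ht := hA.le_samples h h0 h1 hK
  have hK' : (3 : ℝ) ≤ Fintype.card ι := by exact_mod_cast hK
  have hs' : (1 : ℝ) ≤ s := by exact_mod_cast hs
  rcases le_or_gt ((Fintype.card ι : ℝ) / 20) s with hbig | hsmall
  · nlinarith [mul_le_mul ht hbig (by positivity) (by positivity)]
  set m := Fintype.card ι * s with hm
  have hm0 : 0 < m := by positivity
  have hmK : (m : ℝ) = Fintype.card ι * s := by rw [hm]; push_cast; ring
  have hq : m * ρ ^ 2 ≤ 1 / 20 := by
    rw [hmK]
    have h2 : (ρ * Fintype.card ι) ^ 2 ≤ 1 := pow_le_one₀ (by positivity) hρ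
    have h3 : (Fintype.card ι : ℝ) * s * ρ ^ 2 * Fintype.card ι ≤ 1 / 20 * Fintype.card ι := by
      calc (Fintype.card ι : ℝ) * s * ρ ^ 2 * (Fintype.card ι : ℝ)
          = (s : ℝ) * (ρ * Fintype.card ι) ^ 2 := by ring
        _ ≤ (s : ℝ) * 1 := mul_le_mul_of_nonneg_left h2 (by linarith)
        _ ≤ _ := by linarith
    exact le_of_mul_le_mul_right h3 (by linarith)
  -- A full batch fits into the stream, so rounding up the number of batches costs at most a factor
  -- 2.
  have hmt : (m : ℝ) ≤ t := le_of_mul_le_mul_right (hq.trans ht) (by positivity)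
  have hpos : ∀ i x, 0 < w x * (1 + ρ * χ i x) := fun i x =>
    mul_pos (h.weight_pos x) (h.density_pos h0 h1 i x)
  have hchain := sum_relEntropy_stateLaw_le A.paddedStep h.weight_pos h.weight_sum hpos
    (h.sum_relEntropy_batch_le (σ := Fin s → Bool) h0 h1 hs hm hm0 (by simp) hρ (by linarith))
    A.init (t / m + 1)
  have hT : t ≤ (t / m + 1) * m := by
    rw [mul_comm]
    exact (Nat.lt_mul_div_succ t hm0).le
  have hidle : ∀ j x v, 0 + t ≤ j → A.paddedStep j x v = v := fun j x v hj =>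
    dif_neg (by omega)
  -- Idle steps fill the last batch without changing the laws.
  obtain ⟨k, hk⟩ := Nat.exists_eq_add_of_le hT
  have hsum := hA.le_sum_relEntropy h h0 h1 hK
  rw [hk] at hchain
  simp_rw [funext (stateLaw_add_of_idle A.paddedStep h.weight_sum 0 t k hidle A.init)] at hchain
  have hidle' : ∀ i, stateLaw A.paddedStep (fun x => w x * (1 + ρ * χ i x)) 0 (t + k) A.init
      = stateLaw A.paddedStep (fun x => w x * (1 + ρ * χ i x)) 0 t A.init := fun i =>
    funext (stateLaw_add_of_idle A.paddedStep (h.sum_affine i 1 ρ) 0 t k hidle A.init)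
  simp_rw [hidle'] at hchain
  have hTm : ((t / m + 1 : ℕ) : ℝ) * m ≤ 2 * t := by
    have : (((t / m) * m : ℕ) : ℝ) ≤ t := by exact_mod_cast Nat.div_mul_le_self t m
    push_cast at this ⊢
    linarith
  have hfin := hsum.trans hchain
  have h5 : ((t / m + 1 : ℕ) : ℝ) * (95 * s * (m * ρ ^ 2)) ≤ 95 * s * ρ ^ 2 * (2 * t) := by
    calc ((t / m + 1 : ℕ) : ℝ) * (95 * s * (m * ρ ^ 2))
        = 95 * s * ρ ^ 2 * (((t / m + 1 : ℕ) : ℝ) * m) := by ring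
      _ ≤ _ := mul_le_mul_of_nonneg_left hTm (by positivity)
  linarith

end StreamingAlgorithm

/-! ### Parities and the final estimates -/

/-- The parity (Walsh) functions on the discrete cube are uncorrelated signs. -/
theorem isUncorrelatedSigns_parity (d r : ℕ) (hr : 0 < r) :
    IsUncorrelatedSigns (fun _ : Fin d → ℤˣ => (2 : ℝ)⁻¹ ^ d)
      (fun (I : {I : Finset (Fin d) // I.card = r}) (x : Fin d → ℤˣ) =>
        ∏ i ∈ I.1, (((x i : ℤˣ) : ℤ) : ℝ)) := by
  have hsum : ∑ _x : Fin d → ℤˣ, (2 : ℝ)⁻¹ ^ d = 1 := by simp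
  have hmean : ∀ J : Finset (Fin d), J.Nonempty →
      ∑ x : Fin d → ℤˣ, (2 : ℝ)⁻¹ ^ d * ∏ i ∈ J, (((x i : ℤˣ) : ℤ) : ℝ) = 0 := fun J hJ => by
    have h := correlatedDist_sum 1 hJ
    simp only [correlatedDist, one_mul, mul_add, mul_one, Finset.sum_add_distrib] at h
    linarith
  have hsq : ∀ (x : Fin d → ℤˣ) i, (((x i : ℤˣ) : ℤ) : ℝ) ^ 2 = 1 := fun x i => by
    rcases Int.units_eq_one_or (x i) with h | h <;> simp [h]
  have hsqp : ∀ (J : Finset (Fin d)) (x : Fin d → ℤˣ),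
      (∏ i ∈ J, (((x i : ℤˣ) : ℤ) : ℝ)) ^ 2 = 1 := fun J x => by
    rw [← Finset.prod_pow]
    exact Finset.prod_eq_one fun i _ => hsq x i
  refine ⟨fun _ => by positivity, hsum, fun I x => hsqp I.1 x, fun I => hmean _ ?_,
    fun I J hIJ => ?_⟩
  · exact Finset.card_pos.1 (by rw [I.2]; exact hr)
  · have hne : (symmDiff I.1 J.1).Nonempty := by
      rw [Finset.symmDiff_nonempty]
      exact fun h => hIJ (Subtype.ext h)
    -- χ_I χ_J is the parity over the symmetric difference, since the common factors square to 1.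
    rw [← hmean _ hne]
    refine Finset.sum_congr rfl fun x _ => ?_
    congr 1
    rw [← Finset.prod_sdiff (Finset.inter_subset_left (s₁ := I.1) (s₂ := J.1)),
      ← Finset.prod_sdiff (Finset.inter_subset_right (s₁ := I.1) (s₂ := J.1)),
      Finset.sdiff_inter_self_left, Finset.sdiff_inter_self_right,
      show symmDiff I.1 J.1 = (I.1 \ J.1) ∪ (J.1 \ I.1) from rfl,
      Finset.prod_union disjoint_sdiff_sdiff]
    linear_combination (∏ i ∈ I.1 \ J.1, (((x i : ℤˣ) : ℤ) : ℝ)) *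
      (∏ i ∈ J.1 \ I.1, (((x i : ℤˣ) : ℤ) : ℝ)) * hsqp (I.1 ∩ J.1) x

/-- The memory-sample tradeoff for correlations of order `r`, for `ρ` at most `d ^ (-r)`. -/
theorem choose_div_le_of_identifies {d r : ℕ} (hr : 2 ≤ r) (hd : r + 1 ≤ d) {ρ : ℝ} (h0 : 0 < ρ)
    (h1 : ρ < 1) (hρ : ρ ≤ (d : ℝ) ^ (-(r : ℝ))) {t s : ℕ} (hs : 1 ≤ s)
    (A : StreamingAlgorithm (Fin d → ℤˣ) {I : Finset (Fin d) // I.card = r} t s)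
    (hA : A.Identifies (orderCorrelations d r ρ) (1 / 3)) :
    (d.choose r : ℝ) / (1900 * ρ ^ 2 * Real.log (d.choose r)) ≤ (t : ℝ) * (s : ℝ) := by
  have hcard : Fintype.card {I : Finset (Fin d) // I.card = r} = d.choose r := by simp
  have hdpos : (0 : ℝ) < d := by exact_mod_cast (by omega : 0 < d)
  have hK : 3 ≤ d.choose r := by
    calc 3 ≤ r + 1 := by omega
      _ = (r + 1).choose r := (Nat.choose_succ_self_right r).symm
      _ ≤ d.choose r := Nat.choose_le_choose r hd
  have hK' : (3 : ℝ) ≤ d.choose r := by exact_mod_cast hK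
  have hρK : ρ * (d.choose r : ℝ) ≤ 1 := by
    have h2 : (d.choose r : ℝ) ≤ (d : ℝ) ^ r := by exact_mod_cast Nat.choose_le_pow d r
    rw [Real.rpow_neg hdpos.le, Real.rpow_natCast] at hρ
    calc ρ * (d.choose r : ℝ) ≤ ((d : ℝ) ^ r)⁻¹ * (d : ℝ) ^ r :=
          mul_le_mul hρ h2 (by positivity) (by positivity)
      _ = 1 := inv_mul_cancel₀ (by positivity)
  have hmain := StreamingAlgorithm.Identifies.card_le_mul (A := A)
    (isUncorrelatedSigns_parity d r (by omega)) h0 h1 hs (by rw [hcard]; exact hK)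
    (by rw [hcard]; exact hρK) hA
  rw [hcard] at hmain
  -- Since K ≥ 3 > e, dividing by log K only weakens the bound.
  have hlog : 1 ≤ Real.log (d.choose r) := by
    rw [Real.le_log_iff_exp_le (by linarith)]
    linarith [Real.exp_one_lt_d9]
  rw [div_le_iff₀ (by positivity)]
  have h3 : 0 ≤ 1900 * ρ ^ 2 * ((t : ℝ) * s) := by positivity
  nlinarith [mul_le_mul_of_nonneg_left hlog h3]

theorem mainTheorem9 :
    ∃ C' : ℝ, 0 < C' ∧ ∃ C : ℕ → ℝ, (∀ r, 0 < C r) ∧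
      (∀ d r : ℕ, 2 ≤ r → r + 1 ≤ d → ∀ ρ : ℝ, 0 < ρ → ρ < 1 →
        ρ ≤ (d : ℝ) ^ (-(3 * (r : ℝ) / 2)) * (Real.log d) ^ (-(1 / 2 : ℝ)) / C r →
        ∀ t s : ℕ, 1 ≤ t → 1 ≤ s →
        ∀ A : StreamingAlgorithm (Fin d → ℤˣ) {I : Finset (Fin d) // I.card = r} t s,
          A.Identifies (orderCorrelations d r ρ) (1 / 3) →
          (d.choose r : ℝ) / (C' * ρ ^ 2 * Real.log (d.choose r)) ≤ (t : ℝ) * (s : ℝ)) ∧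
      (∀ r : ℕ, 2 ≤ r → Odd r → ∀ ε : ℝ, 0 < ε → ε < 1 → ∃ Crε : ℝ, 1 ≤ Crε ∧
        ∀ d : ℕ, r + 1 ≤ d → ∀ ρ : ℝ, 0 < ρ → ρ < 1 →
        ρ ≤ (d : ℝ) ^ (-((1 + ε) * (r : ℝ))) / Crε →
        ∀ t s : ℕ, 1 ≤ t → 1 ≤ s →
        ∀ A : StreamingAlgorithm (Fin d → ℤˣ) {I : Finset (Fin d) // I.card = r} t s,
          A.Identifies (orderCorrelations d r ρ) (1 / 3) →
          (d.choose r : ℝ) / (C' * ρ ^ 2 * Real.log (d.choose r)) ≤ (t : ℝ) * (s : ℝ)) := by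
  -- 1900 = 10 · 95 · 2: the lower bound K/10, the cost of a batch, and the rounding of the batch
  -- count. Unit constants suffice in both ranges, as each exponent of d is at most -r and log d ≥
  -- 1.
  refine ⟨1900, by norm_num, fun _ => 1, fun _ => one_pos, ?_, ?_⟩
  · intro d r hr hd ρ h0 h1 hρ t s _ hs A hA
    refine choose_div_le_of_identifies hr hd h0 h1 (hρ.trans ?_) hs A hA
    have hd3 : (3 : ℝ) ≤ d := by exact_mod_cast (by omega : 3 ≤ d)
    have hlog : 1 ≤ Real.log d := by
      rw [Real.le_log_iff_exp_le (by linarith)]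
      linarith [Real.exp_one_lt_d9]
    rw [div_one]
    calc _ ≤ (d : ℝ) ^ (-(3 * (r : ℝ) / 2)) * 1 :=
          mul_le_mul_of_nonneg_left (Real.rpow_le_one_of_one_le_of_nonpos hlog (by norm_num))
            (by positivity)
      _ ≤ (d : ℝ) ^ (-(r : ℝ)) := by
          rw [mul_one]
          exact Real.rpow_le_rpow_of_exponent_le (by linarith)
            (by linarith [Nat.cast_nonneg (α := ℝ) r])
  · intro r hr _ ε hε _
    refine ⟨1, le_rfl, fun d hd ρ h0 h1 hρ t s _ hs A hA => ?_⟩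
    refine choose_div_le_of_identifies hr hd h0 h1 (hρ.trans ?_) hs A hA
    rw [div_one]
    refine Real.rpow_le_rpow_of_exponent_le (by exact_mod_cast (by omega : 1 ≤ d)) ?_
    nlinarith [Nat.cast_nonneg (α := ℝ) r]
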